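/- All Banach spaces are complex, and Banach algebras need not be unital. For a Banach algebra $A$, a Banach $A$-bimodule is a Banach space $X$ with commuting, associative, bounded bilinear left and right actions of $A$. Let $C^n(A,X)$ be the Banach space of bounded $n$-linear maps $A\times\cdots\times A\to X$ (with $C^0(A,X)=X$), and let $\delta^n:C^n(A,X)\to C^{n+1}(A,X)$ be $$(\delta^n f)(a_1,\dots,a_{n+1})=a_1\cdot f(a_2,\dots,a_{n+1})+\sum_{i=1}^n(-1)^i f(a_1,\dots,a_ia_{i+1},\dots,a_{n+1})+(-1)^{n+1}f(a_1,\dots,a_n)\cdot a_{n+1}.$$ Put $\mathcal H^0(A,X)=\ker\delta^0$ and $\mathcal H^n(A,X)=\ker\delta^n/\operatorname{im}\delta^{n-1}$ for $n\ge1$, with the quotient seminorm. A dual $A$-bimodule is the dual space $M=(M_*)^*$ of a Banach $A$-bimodule $M_*$, with $(a\cdot f)(x)=f(x\cdot a)$ and $(f\cdot a)(x)=f(a\cdot x)$. A Banach algebra $A$ is amenable if $\mathcal H^1(A,M)=\{0\}$ for every dual $A$-bimodule $M$. **Theorem 2.1.** Let $A$ be a Banach algebra and let $I$ be a closed two-sided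 ideal of $A$ (in particular a linear subspace) which is an amenable Banach algebra. Let $\theta:A\to A/I$ be the quotient map and let $M$ be a dual $A/I$-bimodule, regarded also as an $A$-bimodule via $a\cdot m=\theta(a)\cdot m$ and $m\cdot a=m\cdot\theta(a)$. Then for every $n\ge0$ the map $$\mathcal H^n(A/I,M)\to\mathcal H^n(A,M),$$ sending the class of a cocycle $\rho$ to the class of $(a_1,\dots,a_n)\mapsto\rho(\theta(a_1),\dots,\theta(a_n))$, is a well-defined topological isomorphism of seminormed spaces (a linear bijection that is continuous with continuous inverse). -/

import Mathlib

/-! Bounded (Banach) cohomology of complex Banach algebras, not necessarily unital.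

A Banach algebra is a type `A` with `[NonUnitalNormedRing A] [NormedSpace ℂ A]
[IsScalarTower ℂ A A] [SMulCommClass ℂ A A] [CompleteSpace A]`. -/

universe u v w

noncomputable section

namespace BanachCohomology

/-- The structure of a Banach `A`-bimodule on the Banach space `X`: commuting, associative,
jointly continuous (that is, bounded bilinear) left and right actions of `A`.
Here `left a x` is `a · x` and `right a x` is `x · a`. -/
structure Bimodule (A : Type u) [NonUnitalNormedRing A] [NormedSpace ℂ A]
    (X : Type v) [NormedAddCommGroup X] [NormedSpace ℂ X] where
  left : A →L[ℂ] X →L[ℂ] X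
  right : A →L[ℂ] X →L[ℂ] X
  left_mul : ∀ (a b : A) (x : X), left (a * b) x = left a (left b x)
  right_mul : ∀ (a b : A) (x : X), right (a * b) x = right b (right a x)
  left_right : ∀ (a b : A) (x : X), right b (left a x) = left a (right b x)

section Bimodules

variable {A : Type u} [NonUnitalNormedRing A] [NormedSpace ℂ A]
  {B : Type w} [NonUnitalNormedRing B] [NormedSpace ℂ B]
  {X : Type v} [NormedAddCommGroup X] [NormedSpace ℂ X]

/-- Precomposition of functionals with operators, `T ↦ (f ↦ f ∘ T)`, as a bounded map. -/
def transposeL : (X →L[ℂ] X) →L[ℂ] (StrongDual ℂ X →L[ℂ] StrongDual ℂ X) :=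
  (ContinuousLinearMap.compL ℂ X X ℂ).flip

/-- The dual bimodule on `X* = StrongDual ℂ X`: `(a · f)(x) = f(x · a)` and
`(f · a)(x) = f(a · x)`. -/
def Bimodule.dual (P : Bimodule A X) : Bimodule A (StrongDual ℂ X) where
  left := transposeL ∘L P.right
  right := transposeL ∘L P.left
  left_mul a b f := by
    ext x
    simp [transposeL, P.right_mul]
  right_mul a b f := by
    ext x
    simp [transposeL, P.left_mul]
  left_right a b f := by
    ext x
    simp [transposeL, P.left_right]

/-- A `B`-bimodule becomes an `A`-bimodule along a bounded homomorphism `φ : A → B`: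
`a · x = φ(a) · x` and `x · a = x · φ(a)`. -/
def Bimodule.restrict (P : Bimodule B X) (φ : A →L[ℂ] B) (hφ : ∀ a b, φ (a * b) = φ a * φ b) :
    Bimodule A X where
  left := P.left ∘L φ
  right := P.right ∘L φ
  left_mul a b x := by simp [hφ, P.left_mul]
  right_mul a b x := by simp [hφ, P.right_mul]
  left_right a b x := by simp [P.left_right]

end Bimodules

section Cochains

/-- `C^n(A, X)`: bounded `n`-linear maps from `A × ⋯ × A` to `X`, with the operator norm.
For `n = 0` these are the elements of `X`. -/
abbrev Cochain (A : Type u) [NonUnitalNormedRing A] [NormedSpace ℂ A]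
    (X : Type v) [NormedAddCommGroup X] [NormedSpace ℂ X] (n : ℕ) : Type (max u v) :=
  ContinuousMultilinearMap ℂ (fun _ : Fin n => A) X

variable {A : Type u} [NonUnitalNormedRing A] [NormedSpace ℂ A]
  {X : Type v} [NormedAddCommGroup X] [NormedSpace ℂ X]

/-- Contraction after changing one argument changes exactly one argument of the outcome, and does
so through an additive and homogeneous map. -/
theorem contractNth_update [IsScalarTower ℂ A A] [SMulCommClass ℂ A A] {n : ℕ} (i : Fin n)
    (m : Fin (n + 1) → A) (k : Fin (n + 1)) :
    ∃ (j : Fin n) (L : A →ₗ[ℂ] A) (m' : Fin n → A), ∀ x : A,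
      Fin.contractNth i.castSucc (· * ·) (Function.update m k x) = Function.update m' j (L x) := by
  rcases lt_trichotomy (k : ℕ) (i : ℕ) with h | h | h
  · refine ⟨⟨k, by omega⟩, LinearMap.id, Fin.contractNth i.castSucc (· * ·) m, fun x => ?_⟩
    ext l
    simp only [Fin.contractNth, Function.update_apply, Fin.ext_iff, Fin.val_castSucc,
      Fin.val_succ, LinearMap.id_apply]
    split_ifs <;> first | rfl | omega
  · refine ⟨i, LinearMap.mulRight ℂ (m i.succ), Fin.contractNth i.castSucc (· * ·) m,
      fun x => ?_⟩
    ext l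
    by_cases hl : l = i
    · subst hl
      simp [Fin.contractNth, Function.update_apply, Fin.ext_iff, ← h]
    · have hl' : (l : ℕ) ≠ i := fun e => hl (Fin.ext e)
      simp only [Fin.contractNth, Function.update_apply, Fin.ext_iff, Fin.val_castSucc,
        Fin.val_succ]
      split_ifs <;> first | rfl | omega
  · by_cases h' : (k : ℕ) = i + 1
    · refine ⟨i, LinearMap.mulLeft ℂ (m i.castSucc), Fin.contractNth i.castSucc (· * ·) m,
        fun x => ?_⟩
      ext l
      by_cases hl : l = i
      · subst hl
        simp [Fin.contractNth, Function.update_apply, Fin.ext_iff, h']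
      · have hl' : (l : ℕ) ≠ i := fun e => hl (Fin.ext e)
        simp only [Fin.contractNth, Function.update_apply, Fin.ext_iff, Fin.val_castSucc,
          Fin.val_succ]
        split_ifs <;> first | rfl | omega
    · refine ⟨⟨k - 1, by omega⟩, LinearMap.id, Fin.contractNth i.castSucc (· * ·) m,
        fun x => ?_⟩
      ext l
      simp only [Fin.contractNth, Function.update_apply, Fin.ext_iff, Fin.val_castSucc,
        Fin.val_succ, LinearMap.id_apply]
      split_ifs <;> first | rfl | omega

/-- The cochain `(a₁, …, aₙ₊₁) ↦ f(a₁, …, aᵢ aᵢ₊₁, …, aₙ₊₁)`; the index `i : Fin n` counts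
from `0`. -/
def contract [IsScalarTower ℂ A A] [SMulCommClass ℂ A A] {n : ℕ} (f : Cochain A X n)
    (i : Fin n) : Cochain A X (n + 1) where
  toFun m := f (Fin.contractNth i.castSucc (· * ·) m)
  map_update_add' {inst} m k x y := by
    rw [Subsingleton.elim inst (instDecidableEqFin (n + 1))]
    obtain ⟨j, L, m', h⟩ := contractNth_update i m k
    rw [h, h, h, map_add, f.map_update_add]
  map_update_smul' {inst} m k c x := by
    rw [Subsingleton.elim inst (instDecidableEqFin (n + 1))]
    obtain ⟨j, L, m', h⟩ := contractNth_update i m k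
    rw [h, h, map_smul, f.map_update_smul]
  cont := by
    refine f.cont.comp (continuous_pi fun l => ?_)
    unfold Fin.contractNth
    split_ifs <;> fun_prop

/-- The cochain `(a₁, …, aₙ₊₁) ↦ a₁ · f(a₂, …, aₙ₊₁)`. -/
def leftTerm (P : Bimodule A X) {n : ℕ} (f : Cochain A X n) : Cochain A X (n + 1) :=
  ContinuousLinearMap.uncurryLeft (Ei := fun _ : Fin (n + 1) => A)
    (((ContinuousLinearMap.compContinuousMultilinearMapL ℂ (fun _ : Fin n => A) X X).flip f) ∘L
      P.left)

/-- The cochain `(a₁, …, aₙ₊₁) ↦ f(a₁, …, aₙ) · aₙ₊₁`. -/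
def rightTerm (P : Bimodule A X) {n : ℕ} (f : Cochain A X n) : Cochain A X (n + 1) :=
  ContinuousMultilinearMap.uncurryRight (Ei := fun _ : Fin (n + 1) => A)
    (P.right.flip.compContinuousMultilinearMap f)

theorem leftTerm_apply (P : Bimodule A X) {n : ℕ} (f : Cochain A X n) (a : Fin (n + 1) → A) :
    leftTerm P f a = P.left (a 0) (f (Fin.tail a)) := rfl

theorem rightTerm_apply (P : Bimodule A X) {n : ℕ} (f : Cochain A X n) (a : Fin (n + 1) → A) :
    rightTerm P f a = P.right (a (Fin.last n)) (f (Fin.init a)) := rfl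

theorem contract_apply [IsScalarTower ℂ A A] [SMulCommClass ℂ A A] {n : ℕ} (f : Cochain A X n)
    (i : Fin n) (a : Fin (n + 1) → A) :
    contract f i a = f (Fin.contractNth i.castSucc (· * ·) a) := rfl

variable [IsScalarTower ℂ A A] [SMulCommClass ℂ A A]

/-- The coboundary operator `δ^n : C^n(A, X) → C^{n+1}(A, X)`,
`(δ^n f)(a₁, …, aₙ₊₁) = a₁ · f(a₂, …, aₙ₊₁) + ∑_{i=1}^n (-1)^i f(a₁, …, aᵢ aᵢ₊₁, …, aₙ₊₁)
  + (-1)^{n+1} f(a₁, …, aₙ) · aₙ₊₁`. -/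
def coboundary (P : Bimodule A X) (n : ℕ) : Cochain A X n →ₗ[ℂ] Cochain A X (n + 1) where
  toFun f := leftTerm P f + ∑ i : Fin n, (-1 : ℂ) ^ ((i : ℕ) + 1) • contract f i
    + (-1 : ℂ) ^ (n + 1) • rightTerm P f
  map_add' f g := by
    ext a
    simp only [add_apply, sum_apply,
      smul_apply, leftTerm_apply, rightTerm_apply, contract_apply,
      map_add, smul_add, Finset.sum_add_distrib]
    abel
  map_smul' c f := by
    ext a
    simp only [add_apply, sum_apply,
      smul_apply, leftTerm_apply, rightTerm_apply, contract_apply,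
      map_smul, smul_add, Finset.smul_sum, RingHom.id_apply, smul_comm c]

theorem coboundary_apply (P : Bimodule A X) (n : ℕ) (f : Cochain A X n) (a : Fin (n + 1) → A) :
    coboundary P n f a = P.left (a 0) (f (Fin.tail a))
      + ∑ i : Fin n, (-1 : ℂ) ^ ((i : ℕ) + 1) • f (Fin.contractNth i.castSucc (· * ·) a)
      + (-1 : ℂ) ^ (n + 1) • P.right (a (Fin.last n)) (f (Fin.init a)) := by
  simp [coboundary, leftTerm_apply, rightTerm_apply, contract_apply]

/-- The space `Z^n(A, X)` of `n`-cocycles. -/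
def cocycles (P : Bimodule A X) (n : ℕ) : Submodule ℂ (Cochain A X n) :=
  LinearMap.ker (coboundary P n)

/-- The space `N^n(A, X)` of `n`-coboundaries; it is zero for `n = 0`. -/
def coboundaries (P : Bimodule A X) : ∀ n : ℕ, Submodule ℂ (Cochain A X n)
  | 0 => ⊥
  | n + 1 => LinearMap.range (coboundary P n)

/-- The Banach cohomology group `H^n(A, X) = Z^n(A, X) / N^n(A, X)`. It carries the quotient
seminorm of the operator norm. (As `δ ∘ δ = 0`, every coboundary lies in `Z^n(A, X)`.) -/
abbrev Cohomology (P : Bimodule A X) (n : ℕ) : Type (max u v) :=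
  cocycles P n ⧸ (coboundaries P n).submoduleOf (cocycles P n)

end Cochains

/-- The Banach algebra `A` is amenable: `H^1(A, E*) = 0` for each Banach `A`-bimodule `E`. -/
def IsAmenable (A : Type u) [NonUnitalNormedRing A] [NormedSpace ℂ A] [IsScalarTower ℂ A A]
    [SMulCommClass ℂ A A] : Prop :=
  ∀ (E : Type v) [NormedAddCommGroup E] [NormedSpace ℂ E] [CompleteSpace E] (P : Bimodule A E),
    Subsingleton (Cohomology P.dual 1)

section Pullback

variable {A : Type u} [NonUnitalNormedRing A] [NormedSpace ℂ A]
  {B : Type w} [NonUnitalNormedRing B] [NormedSpace ℂ B]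
  {X : Type v} [NormedAddCommGroup X] [NormedSpace ℂ X]

/-- Pulling back cochains along `φ : A → B`: `f ↦ ((a₁, …, aₙ) ↦ f(φ(a₁), …, φ(aₙ)))`. -/
def pullback (X : Type v) [NormedAddCommGroup X] [NormedSpace ℂ X] (φ : A →L[ℂ] B) (n : ℕ) :
    Cochain B X n →ₗ[ℂ] Cochain A X n where
  toFun f := f.compContinuousLinearMap fun _ => φ
  map_add' _ _ := rfl
  map_smul' _ _ := rfl

theorem pullback_apply (φ : A →L[ℂ] B) (n : ℕ) (f : Cochain B X n) (a : Fin n → A) :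
    pullback X φ n f a = f fun i => φ (a i) := rfl

variable [IsScalarTower ℂ A A] [SMulCommClass ℂ A A] [IsScalarTower ℂ B B] [SMulCommClass ℂ B B]

theorem coboundary_pullback (P : Bimodule B X) (φ : A →L[ℂ] B)
    (hφ : ∀ a b, φ (a * b) = φ a * φ b) (n : ℕ) (f : Cochain B X n) :
    coboundary (P.restrict φ hφ) n (pullback X φ n f) =
      pullback X φ (n + 1) (coboundary P n f) := by
  ext a
  have key : ∀ i : Fin n, (fun j => φ (Fin.contractNth i.castSucc (· * ·) a j)) =
      Fin.contractNth i.castSucc (· * ·) fun j => φ (a j) := fun i =>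
    Fin.comp_contractNth (· * ·) (· * ·) (f := φ) hφ i.castSucc a
  simp only [coboundary_apply, pullback_apply, key]
  rfl

/-- Pulling back cocycles along a bounded homomorphism. -/
def pullbackCocycles (P : Bimodule B X) (φ : A →L[ℂ] B) (hφ : ∀ a b, φ (a * b) = φ a * φ b)
    (n : ℕ) : cocycles P n →ₗ[ℂ] cocycles (P.restrict φ hφ) n :=
  (pullback X φ n).restrict fun f hf => by
    have hf' : coboundary P n f = 0 := hf
    change coboundary (P.restrict φ hφ) n (pullback X φ n f) = 0
    rw [coboundary_pullback, hf', map_zero]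

/-- The map `H^n(B, X) → H^n(A, X)` induced by a bounded homomorphism `φ : A → B`: the class of
a cocycle `f` goes to the class of `(a₁, …, aₙ) ↦ f(φ(a₁), …, φ(aₙ))`. -/
def cohomologyMap (P : Bimodule B X) (φ : A →L[ℂ] B) (hφ : ∀ a b, φ (a * b) = φ a * φ b)
    (n : ℕ) : Cohomology P n →ₗ[ℂ] Cohomology (P.restrict φ hφ) n :=
  Submodule.mapQ _ _ (pullbackCocycles P φ hφ n) fun f hf => by
    have hf' : (f : Cochain B X n) ∈ coboundaries P n := hf
    change pullback X φ n f ∈ coboundaries (P.restrict φ hφ) n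
    cases n with
    | zero =>
      have h0 : (f : Cochain B X 0) = 0 := hf'
      rw [h0, map_zero]
      exact Submodule.zero_mem _
    | succ n =>
      obtain ⟨g, hg⟩ := hf'
      exact ⟨pullback X φ n g, by rw [coboundary_pullback, hg]⟩

end Pullback

section Ideals

/-- A closed two-sided ideal of the Banach algebra `A`. -/
structure ClosedIdeal (A : Type u) [NonUnitalNormedRing A] [NormedSpace ℂ A] extends
    Submodule ℂ A where
  mul_mem_left : ∀ (a : A) {x : A}, x ∈ carrier → a * x ∈ carrier
  mul_mem_right : ∀ (a : A) {x : A}, x ∈ carrier → x * a ∈ carrier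
  isClosed : IsClosed carrier

variable {A : Type u} [NonUnitalNormedRing A] [NormedSpace ℂ A]

namespace ClosedIdeal

/-- A closed ideal is a closed subalgebra, and so a Banach algebra in its own right, with the
norm and the operations of `A`. -/
def subalgebra (I : ClosedIdeal A) : NonUnitalSubalgebra ℂ A where
  toNonUnitalSubsemiring :=
    { I.toSubmodule.toAddSubmonoid with
      mul_mem' := fun {a _} _ hb => I.mul_mem_left a hb }
  smul_mem' := I.toSubmodule.smul_mem'

instance (I : ClosedIdeal A) : NormedSpace ℂ I.subalgebra where
  norm_smul_le c x := norm_smul_le c (x : A)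

instance [CompleteSpace A] (I : ClosedIdeal A) : CompleteSpace I.subalgebra :=
  I.isClosed.completeSpace_coe

/-- The quotient Banach algebra `A / I`, with the quotient norm. -/
def Quotient (I : ClosedIdeal A) : Type u := A ⧸ I.toSubmodule

variable (I : ClosedIdeal A)

instance : IsClosed (I.toSubmodule : Set A) := I.isClosed

instance : NormedAddCommGroup I.Quotient :=
  inferInstanceAs (NormedAddCommGroup (A ⧸ I.toSubmodule))

instance : NormedSpace ℂ I.Quotient :=
  inferInstanceAs (NormedSpace ℂ (A ⧸ I.toSubmodule))

instance [CompleteSpace A] : CompleteSpace I.Quotient :=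
  inferInstanceAs (CompleteSpace (A ⧸ I.toSubmodule))

/-- The quotient map `A → A / I`. -/
def quotMap : A →L[ℂ] I.Quotient where
  toFun a := (Submodule.Quotient.mk a : A ⧸ I.toSubmodule)
  map_add' _ _ := rfl
  map_smul' _ _ := rfl
  cont := continuous_quot_mk

theorem quotMap_surjective : Function.Surjective I.quotMap :=
  Submodule.Quotient.mk_surjective I.toSubmodule

theorem quotMap_eq_iff {a b : A} : I.quotMap a = I.quotMap b ↔ a - b ∈ I.toSubmodule :=
  Submodule.Quotient.eq I.toSubmodule

theorem norm_quotMap_le (a : A) : ‖I.quotMap a‖ ≤ ‖a‖ :=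
  Submodule.Quotient.norm_mk_le (S := I.toSubmodule) a

theorem exists_norm_lt (x : I.Quotient) {ε : ℝ} (hε : 0 < ε) :
    ∃ a, I.quotMap a = x ∧ ‖a‖ < ‖x‖ + ε :=
  Submodule.Quotient.norm_mk_lt (S := I.toSubmodule) x hε

/-- The product `(a + I)(b + I) = ab + I`. -/
instance : Mul I.Quotient where
  mul x y := Quotient.liftOn₂' x y (fun a b => I.quotMap (a * b)) fun a b a' b' ha hb => by
    have ha' : a - a' ∈ I.toSubmodule := (Submodule.quotientRel_def _).1 ha
    have hb' : b - b' ∈ I.toSubmodule := (Submodule.quotientRel_def _).1 hb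
    refine I.quotMap_eq_iff.2 ?_
    have e : a * b - a' * b' = (a - a') * b + a' * (b - b') := by noncomm_ring
    rw [e]
    exact I.toSubmodule.add_mem (I.mul_mem_right b ha') (I.mul_mem_left a' hb')

theorem quotMap_mul (a b : A) : I.quotMap (a * b) = I.quotMap a * I.quotMap b := rfl

instance : NonUnitalNormedRing I.Quotient where
  __ := (inferInstance : NormedAddCommGroup I.Quotient)
  mul := (· * ·)
  left_distrib x y z := by
    obtain ⟨a, rfl⟩ := I.quotMap_surjective x
    obtain ⟨b, rfl⟩ := I.quotMap_surjective y
    obtain ⟨c, rfl⟩ := I.quotMap_surjective z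
    exact congrArg I.quotMap (mul_add a b c)
  right_distrib x y z := by
    obtain ⟨a, rfl⟩ := I.quotMap_surjective x
    obtain ⟨b, rfl⟩ := I.quotMap_surjective y
    obtain ⟨c, rfl⟩ := I.quotMap_surjective z
    exact congrArg I.quotMap (add_mul a b c)
  zero_mul x := by
    obtain ⟨a, rfl⟩ := I.quotMap_surjective x
    exact congrArg I.quotMap (zero_mul a)
  mul_zero x := by
    obtain ⟨a, rfl⟩ := I.quotMap_surjective x
    exact congrArg I.quotMap (mul_zero a)
  mul_assoc x y z := by
    obtain ⟨a, rfl⟩ := I.quotMap_surjective x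
    obtain ⟨b, rfl⟩ := I.quotMap_surjective y
    obtain ⟨c, rfl⟩ := I.quotMap_surjective z
    exact congrArg I.quotMap (mul_assoc a b c)
  norm_mul_le x y := by
    have h : ∀ ε : ℝ, 0 < ε → ‖x * y‖ ≤ (‖x‖ + ε) * (‖y‖ + ε) := fun ε hε => by
      obtain ⟨a, rfl, ha⟩ := I.exists_norm_lt x hε
      obtain ⟨b, rfl, hb⟩ := I.exists_norm_lt y hε
      rw [← quotMap_mul]
      exact (I.norm_quotMap_le _).trans ((norm_mul_le a b).trans
        (mul_le_mul ha.le hb.le (norm_nonneg _) ((norm_nonneg a).trans ha.le)))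
    have hc : Filter.Tendsto (fun ε : ℝ => (‖x‖ + ε) * (‖y‖ + ε)) (nhdsWithin 0 (Set.Ioi 0))
        (nhds (‖x‖ * ‖y‖)) := by
      have : Continuous fun ε : ℝ => (‖x‖ + ε) * (‖y‖ + ε) := by fun_prop
      simpa using (this.tendsto 0).mono_left nhdsWithin_le_nhds
    exact ge_of_tendsto hc (Filter.eventually_of_mem self_mem_nhdsWithin fun ε hε => h ε hε)

instance [IsScalarTower ℂ A A] : IsScalarTower ℂ I.Quotient I.Quotient where
  smul_assoc c x y := by
    obtain ⟨a, rfl⟩ := I.quotMap_surjective x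
    obtain ⟨b, rfl⟩ := I.quotMap_surjective y
    exact congrArg I.quotMap (smul_assoc c a b)

instance [SMulCommClass ℂ A A] : SMulCommClass ℂ I.Quotient I.Quotient where
  smul_comm c x y := by
    obtain ⟨a, rfl⟩ := I.quotMap_surjective x
    obtain ⟨b, rfl⟩ := I.quotMap_surjective y
    exact congrArg I.quotMap (smul_comm c a b)

end ClosedIdeal

end Ideals

end BanachCohomology

end

/-! Amenability of `I` supplies a functional `Φ` on `I*` that behaves like a weak* limit of a
bounded left approximate identity (`IsAmenable.exists_mixedUnit`). Since the coefficients form a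
dual module, `Φ` can be applied to one argument of a cochain `f`: put `e ∈ I` in place `p` and
average over `e`, which gives a cochain `h` with one argument fewer. If `δ f` vanishes on `I` and
`f` already vanishes on `I` before place `p`, then expanding `δ f = 0` with `e` inserted leaves only
`δ` of the inserted cochain and `± f(…, e a_p, …)` (`coboundary_insertNth`). After averaging, `e
a_p` becomes `a_p`, so `f ∓ δ h` also vanishes on `I` in place `p` (`exists_vanishesBelow_succ`).
Doing this for every place shows that `f` is cohomologous to a cochain that factors through `A / I`
(`exists_eq_pullback_add`). For a cocycle `f` this is surjectivity on cohomology. For a cochain `f`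
whose coboundary is pulled back from `A / I` it is injectivity. Openness comes from the open mapping
theorem applied before passing to quotients, because the cohomology spaces need not be Hausdorff
(`isOpenMap_mapQ`). -/

noncomputable section

namespace BanachCohomology

/-! ### Inserting an entry into a tuple versus multiplying neighbours. -/

section Tuples

variable {α : Type*}

theorem insertNth_eq_ite {n : ℕ} (p : Fin (n + 1)) (e : α) (a : Fin n → α) (i : Fin (n + 1)) :
    Fin.insertNth (α := fun _ => α) p e a i =
      if h : (i : ℕ) < p then a ⟨i, by omega⟩
      else if h' : (i : ℕ) = p then e else a ⟨i - 1, by omega⟩ := by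
  obtain rfl | ⟨j, rfl⟩ := Fin.eq_self_or_eq_succAbove p i
  · simp
  · rw [Fin.insertNth_apply_succAbove]
    rcases lt_or_ge j.castSucc p with h | h
    · have h' : (j : ℕ) < p := h
      simp [Fin.succAbove_of_castSucc_lt _ _ h, h']
    · have h' : (p : ℕ) ≤ j := h
      have h1 : ¬ ((j : ℕ) + 1 < p) := by omega
      have h2 : ¬ ((j : ℕ) + 1 = p) := by omega
      simp [Fin.succAbove_of_le_castSucc _ _ h, h1, h2]

theorem contractNth_insertNth_self {n : ℕ} (op : α → α → α) (p : Fin (n + 1)) (e : α)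
    (a : Fin (n + 1) → α) :
    Fin.contractNth p.castSucc op (Fin.insertNth (α := fun _ => α) p.castSucc e a) =
      Function.update a p (op e (a p)) := by
  ext i
  rcases lt_trichotomy (i : ℕ) p with h | h | h
  · rw [Fin.contractNth_apply_of_lt _ _ _ _ (by simpa using h)]
    have : i ≠ p := fun e => by omega
    simp [insertNth_eq_ite, h, this]
  · obtain rfl : i = p := Fin.ext h
    rw [Fin.contractNth_apply_of_eq _ _ _ _ (by simp)]
    simp [insertNth_eq_ite]
  · rw [Fin.contractNth_apply_of_gt _ _ _ _ (by simpa using h)]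
    have : i ≠ p := fun e => by omega
    have h1 : ¬ ((i : ℕ) + 1 < p) := by omega
    have h2 : ¬ ((i : ℕ) + 1 = p) := by omega
    simp [insertNth_eq_ite, h1, h2, this]

theorem contractNth_insertNth_of_le {n : ℕ} (op : α → α → α) (p : Fin (n + 1)) (e : α)
    (a : Fin (n + 1) → α) (j : Fin n) (hj : (p : ℕ) ≤ j) :
    Fin.contractNth j.succ.castSucc op (Fin.insertNth (α := fun _ => α) p.castSucc e a) =
      Fin.insertNth (α := fun _ => α) p e (Fin.contractNth j.castSucc op a) := by
  ext i
  simp only [insertNth_eq_ite, Fin.contractNth, Fin.val_castSucc, Fin.val_succ]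
  split_ifs <;> first
    | rfl
    | omega
    | (congr 2; first | omega | (ext; simp; omega))

theorem init_insertNth {n : ℕ} (p : Fin (n + 1)) (e : α) (a : Fin (n + 1) → α) :
    Fin.init (α := fun _ => α) (Fin.insertNth (α := fun _ => α) p.castSucc e a) =
      Fin.insertNth (α := fun _ => α) p e (Fin.init (α := fun _ => α) a) := by
  ext i
  simp only [insertNth_eq_ite, Fin.init, Fin.val_castSucc]
  split_ifs <;> rfl

end Tuples

/-! ### Cochains vanishing on the ideal, and inserting an element of the ideal. -/

section Averaging

variable {A : Type u} [NonUnitalNormedRing A] [NormedSpace ℂ A]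
  {X : Type v} [NormedAddCommGroup X] [NormedSpace ℂ X]

/-- The cochain `f` vanishes as soon as one of its first `k` arguments lies in `I`. -/
def VanishesBelow (I : ClosedIdeal A) {n : ℕ} (f : Cochain A X n) (k : ℕ) : Prop :=
  ∀ (a : Fin n → A) (i : Fin n), (i : ℕ) < k → a i ∈ I.toSubmodule → f a = 0

/-- An ideal absorbs products on both sides, so an entry in `I` survives a contraction. It never
moves right, and it moves one place left when the contraction takes place strictly before it. -/
theorem contractNth_mem (I : ClosedIdeal A) {n : ℕ} (j : Fin n) (a : Fin (n + 1) → A)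
    (p : Fin (n + 1)) (hp : a p ∈ I.toSubmodule) :
    ∃ i : Fin n, (i : ℕ) ≤ p ∧ ((j : ℕ) < p → (i : ℕ) < p) ∧
      Fin.contractNth j.castSucc (· * ·) a i ∈ I.toSubmodule := by
  rcases lt_trichotomy (p : ℕ) j with h | h | h
  · refine ⟨⟨p, by omega⟩, le_rfl, fun h' => by omega, ?_⟩
    rw [Fin.contractNth_apply_of_lt _ _ _ _ (by simpa using h)]
    exact hp
  · refine ⟨j, h.ge, fun h' => by omega, ?_⟩
    rw [Fin.contractNth_apply_of_eq _ _ _ _ (by simp)]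
    obtain rfl : p = j.castSucc := Fin.ext h
    exact I.mul_mem_right _ hp
  · refine ⟨⟨p - 1, by omega⟩, by simp, fun _ => by dsimp only; omega, ?_⟩
    by_cases h' : (p : ℕ) = j + 1
    · rw [Fin.contractNth_apply_of_eq _ _ _ _ (by simp; omega)]
      have e : (⟨p - 1, by omega⟩ : Fin n).succ = p := Fin.ext (by simp only [Fin.val_succ]; omega)
      rw [e]
      exact I.mul_mem_left _ hp
    · rw [Fin.contractNth_apply_of_gt _ _ _ _ (by simp; omega)]
      have e : (⟨p - 1, by omega⟩ : Fin n).succ = p := Fin.ext (by simp only [Fin.val_succ]; omega)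
      rw [e]
      exact hp

variable [IsScalarTower ℂ A A] [SMulCommClass ℂ A A]

/-- Every summand still has an entry of `I` among the first `k` arguments of `f`, unless that entry
acts from the left, and then it acts as zero. The bound `k ≤ n` keeps the entry away from the last
place, so the right action of `I` plays no role. -/
theorem VanishesBelow.coboundary {I : ClosedIdeal A} (P : Bimodule A X)
    (hl : ∀ a ∈ I.toSubmodule, P.left a = 0) {n k : ℕ} (hk : k ≤ n) {f : Cochain A X n}
    (hf : VanishesBelow I f k) : VanishesBelow I (coboundary P n f) k := by
  intro a i hi ha
  rw [coboundary_apply]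
  have h1 : P.left (a 0) (f (Fin.tail a)) = 0 := by
    by_cases h0 : i = 0
    · rw [← h0, hl _ ha]; rfl
    · obtain ⟨j, rfl⟩ := Fin.exists_succ_eq.2 h0
      rw [hf (Fin.tail a) j (by simp at hi; omega) ha, map_zero]
  have h2 : ∀ j : Fin n, f (Fin.contractNth j.castSucc (· * ·) a) = 0 := fun j => by
    obtain ⟨l, hl, -, hm⟩ := contractNth_mem I j a i ha
    exact hf _ l (by omega) hm
  have h3 : f (Fin.init a) = 0 := hf _ ⟨i, by omega⟩ hi ha
  simp [h1, h2, h3]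

/-- If `f` vanishes on `I` in its first `p` arguments and `δ f` vanishes on `I`, then inserting
`e ∈ I` in place `p` turns `δ` into left multiplication by `e`, on arguments with `a p ∈ I`. -/
theorem coboundary_insertNth {I : ClosedIdeal A} (P : Bimodule A X)
    (hl : ∀ a ∈ I.toSubmodule, P.left a = 0) {n : ℕ} (p : Fin (n + 1))
    (f : Cochain A X (n + 1)) (hf : VanishesBelow I f p)
    (hδ : VanishesBelow I (coboundary P (n + 1) f) (n + 2))
    {e : A} (he : e ∈ I.toSubmodule) (a : Fin (n + 1) → A) (ha : a p ∈ I.toSubmodule) :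
    coboundary P n (f.curryMid p e) a =
      (-1 : ℂ) ^ ((p : ℕ) + 1) • f (Function.update a p (e * a p)) := by
  have h0 := hδ (Fin.insertNth (α := fun _ => A) p.castSucc e a) p.castSucc
    (by simp; omega) (by simpa using he)
  -- The contraction at `p` is singled out: it multiplies `e` into `a p` and gives the right-hand
  -- side of the claim.
  rw [coboundary_apply, Fin.sum_univ_succAbove _ p, contractNth_insertNth_self,
    init_insertNth] at h0
  have hlast : Fin.insertNth (α := fun _ => A) p.castSucc e a (Fin.last (n + 1)) =
      a (Fin.last n) := by
    have h1 : ¬ (n + 1 < (p : ℕ)) := by omega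
    have h2 : ¬ (n + 1 = (p : ℕ)) := by omega
    simp [insertNth_eq_ite, h1, h2, Fin.last]
  have hleft : P.left (Fin.insertNth (α := fun _ => A) p.castSucc e a 0)
      (f (Fin.tail (Fin.insertNth (α := fun _ => A) p.castSucc e a))) = 0 := by
    by_cases hp : p = 0
    · subst hp
      have : Fin.insertNth (α := fun _ => A) (Fin.castSucc (0 : Fin (n + 1))) e a 0 = e := by
        simp
      rw [this, hl e he]; rfl
    · have hp' : (p : ℕ) ≠ 0 := fun h => hp (Fin.ext h)
      rw [hf _ ⟨p - 1, by omega⟩ (by dsimp only; omega), map_zero]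
      have h1 : ¬ ((p : ℕ) - 1 + 1 < p) := by omega
      have h2 : (p : ℕ) - 1 + 1 = p := by omega
      simpa [Fin.tail, insertNth_eq_ite, h1, h2] using he
  have hleft' : P.left (a 0) (f.curryMid p e (Fin.tail a)) = 0 := by
    by_cases hp : p = 0
    · subst hp; rw [hl _ ha]; rfl
    · have hp' : (p : ℕ) ≠ 0 := fun h => hp (Fin.ext h)
      rw [ContinuousMultilinearMap.curryMid_apply, hf _ ⟨p - 1, by omega⟩ (by dsimp only; omega),
        map_zero]
      have h1 : (p : ℕ) - 1 < p := by omega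
      have h2 : (⟨(p : ℕ) - 1, by omega⟩ : Fin n).succ = p := Fin.ext (by simp only [Fin.val_succ]; omega)
      simpa [Fin.tail, insertNth_eq_ite, h1, h2] using ha
  -- A contraction before `p` pushes an entry of `I` below place `p` on both sides, so both terms
  -- are zero. A contraction after `e` has its index raised by one by the insertion, hence the
  -- opposite sign.
  have hterm : ∀ j : Fin n, (-1 : ℂ) ^ ((p.succAbove j : ℕ) + 1) •
      f (Fin.contractNth (p.succAbove j).castSucc (· * ·)
        (Fin.insertNth (α := fun _ => A) p.castSucc e a)) =
      -((-1 : ℂ) ^ ((j : ℕ) + 1) •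
        f.curryMid p e (Fin.contractNth j.castSucc (· * ·) a)) := fun j => by
    rw [ContinuousMultilinearMap.curryMid_apply]
    rcases lt_or_ge j.castSucc p with h | h
    · have h' : (j : ℕ) < p := h
      rw [Fin.succAbove_of_castSucc_lt _ _ h]
      obtain ⟨i, -, hi, hm⟩ := contractNth_mem I j a p ha
      obtain ⟨i', -, hi', hm'⟩ := contractNth_mem I j.castSucc
        (Fin.insertNth (α := fun _ => A) p.castSucc e a) p.castSucc (by simpa using he)
      rw [hf _ i' (by simpa using hi' (by simpa using h')) hm',
        hf _ i.castSucc (hi h')]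
      · simp
      · simpa [insertNth_eq_ite, hi h'] using hm
    · have h' : (p : ℕ) ≤ j := h
      rw [Fin.succAbove_of_le_castSucc _ _ h, contractNth_insertNth_of_le _ _ _ _ _ h',
        Fin.val_succ, pow_succ, mul_neg_one, neg_smul]
  rw [hleft, hlast, Finset.sum_congr rfl fun j _ => hterm j, Finset.sum_neg_distrib] at h0
  rw [coboundary_apply, hleft', ContinuousMultilinearMap.curryMid_apply]
  rw [pow_succ (-1 : ℂ) (n + 1)] at h0
  simp only [mul_neg_one, neg_smul, zero_add] at h0 ⊢
  rw [← sub_eq_zero, ← neg_eq_zero, ← h0]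
  abel

end Averaging

/-! ### The identity `δ ∘ δ = 0`. -/

section SquareZero

theorem sum_eq_sum_castSucc_add_sum_succ {X : Type*} [AddCommMonoid X] {m : ℕ}
    (G : Fin (m + 1) → X) (i : Fin m) :
    ∑ j, G j = ∑ j : Fin m, (if j ≤ i then G j.castSucc else 0) +
      ∑ j : Fin m, (if i ≤ j then G j.succ else 0) := by
  have h : ∀ j, G j = (if j ≤ i.castSucc then G j else 0) +
      (if i.castSucc < j then G j else 0) := fun j => by
    rcases le_or_gt j i.castSucc with h | h
    · simp [h, h.not_gt]
    · simp [h, h.not_ge]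
  rw [Finset.sum_congr rfl fun j _ => h j, Finset.sum_add_distrib, Fin.sum_univ_castSucc,
    Fin.sum_univ_succ (fun j => if i.castSucc < j then G j else 0)]
  have hlast : ¬ Fin.last m ≤ i.castSucc := (Fin.castSucc_lt_last i).not_ge
  simp [hlast, Fin.castSucc_lt_succ_iff]

/-- The index pairs `(j.succ, i)` and `(i.castSucc, j)` with `i ≤ j` exhaust the double sum; `F`
agrees on the two members of each pair and their signs are opposite. -/
theorem sum_sum_neg_one_pow_eq_zero {X : Type*} [AddCommGroup X] [Module ℂ X] {m : ℕ}
    (F : Fin (m + 1) → Fin m → X)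
    (hF : ∀ i j : Fin m, i ≤ j → F j.succ i = F i.castSucc j) :
    ∑ j : Fin (m + 1), ∑ i : Fin m, (-1 : ℂ) ^ ((i : ℕ) + j) • F j i = 0 := by
  have h : ∀ i : Fin m, ∑ j : Fin (m + 1), (-1 : ℂ) ^ ((i : ℕ) + j) • F j i =
      ∑ j : Fin m, ((if j ≤ i then (-1 : ℂ) ^ ((i : ℕ) + j) • F j.castSucc i else 0) -
        (if i ≤ j then (-1 : ℂ) ^ ((i : ℕ) + j) • F j.succ i else 0)) := fun i => by
    rw [sum_eq_sum_castSucc_add_sum_succ _ i, Finset.sum_sub_distrib, sub_eq_add_neg,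
      ← Finset.sum_neg_distrib]
    congr 1
    refine Finset.sum_congr rfl fun j _ => ?_
    split_ifs <;> simp [← add_assoc, pow_succ]
  rw [Finset.sum_comm, Finset.sum_congr rfl fun i _ => h i]
  simp only [Finset.sum_sub_distrib]
  rw [sub_eq_zero, Finset.sum_comm]
  refine Finset.sum_congr rfl fun i _ => Finset.sum_congr rfl fun j _ => ?_
  split_ifs with hij
  · rw [hF i j hij, add_comm]
  · rfl

variable {A : Type u} [NonUnitalNormedRing A] [NormedSpace ℂ A]
  {X : Type v} [NormedAddCommGroup X] [NormedSpace ℂ X]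

theorem tail_contractNth {α : Type*} {n : ℕ} (op : α → α → α) (j : Fin (n + 1))
    (a : Fin (n + 2) → α) :
    Fin.tail (α := fun _ => α) (Fin.contractNth j.succ op a) =
      Fin.contractNth j op (Fin.tail (α := fun _ => α) a) := by
  ext i
  simp only [Fin.tail, Fin.contractNth, Fin.val_succ]
  split_ifs <;> first | rfl | omega

theorem init_contractNth {α : Type*} {n : ℕ} (op : α → α → α) (j : Fin (n + 1))
    (a : Fin (n + 2) → α) :
    Fin.init (α := fun _ => α) (Fin.contractNth j.castSucc op a) =
      Fin.contractNth j op (Fin.init (α := fun _ => α) a) := by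
  ext i
  simp only [Fin.init, Fin.contractNth, Fin.val_castSucc]
  split_ifs <;> rfl

theorem contractNth_contractNth {α : Type*} {n : ℕ} (op : α → α → α)
    (hop : ∀ x y z, op (op x y) z = op x (op y z)) (i j : Fin (n + 1)) (hij : i ≤ j)
    (a : Fin (n + 2) → α) :
    Fin.contractNth i op (Fin.contractNth j.succ op a) =
      Fin.contractNth j op (Fin.contractNth i.castSucc op a) := by
  have hij' : (i : ℕ) ≤ j := hij
  ext k
  simp only [Fin.contractNth, Fin.val_castSucc, Fin.val_succ]
  split_ifs <;> first | rfl | omega | exact (hop _ _ _).symm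

/-- The `i`-th of the `n + 2` summands of the coboundary of an `n`-cochain, without its sign. -/
def face (P : Bimodule A X) {n : ℕ} (f : (Fin n → A) → X) (i : Fin (n + 2))
    (a : Fin (n + 1) → A) : X :=
  Fin.cases (P.left (a 0) (f (Fin.tail a)))
    (fun j : Fin (n + 1) => Fin.lastCases (P.right (a (Fin.last n)) (f (Fin.init a)))
      (fun l : Fin n => f (Fin.contractNth l.castSucc (· * ·) a)) j) i

section

variable (P : Bimodule A X) {n : ℕ} (f : (Fin n → A) → X) (a : Fin (n + 1) → A)

theorem face_zero : face P f 0 a = P.left (a 0) (f (Fin.tail a)) := rfl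

theorem face_last : face P f (Fin.last n).succ a =
    P.right (a (Fin.last n)) (f (Fin.init a)) := by
  change Fin.lastCases (motive := fun _ => X) _ _ (Fin.last n) = _
  exact Fin.lastCases_last

theorem face_succ (l : Fin n) : face P f l.castSucc.succ a =
    f (Fin.contractNth l.castSucc (· * ·) a) := by
  simp [face]

theorem face_sum_smul {ι : Type*} (s : Finset ι) (c : ι → ℂ) (g : ι → (Fin n → A) → X)
    (j : Fin (n + 2)) : face P (fun b => ∑ i ∈ s, c i • g i b) j a =
      ∑ i ∈ s, c i • face P (g i) j a := by
  refine Fin.cases ?_ (fun j => Fin.lastCases ?_ (fun l => ?_) j) j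
  · simp [face_zero]
  · simp only [face_last, map_sum, map_smul]
  · simp only [face_succ]

end

/-- The presimplicial identity. The extreme cases are the three bimodule axioms, and neighbouring
contractions commute by associativity of the product. -/
theorem face_face (P : Bimodule A X) {n : ℕ} (f : (Fin n → A) → X) (a : Fin (n + 2) → A)
    {i j : Fin (n + 2)} (hij : i ≤ j) :
    face P (face P f i) j.succ a = face P (face P f j) i.castSucc a := by
  induction i using Fin.cases with
  | zero =>
    rw [Fin.castSucc_zero, face_zero]
    induction j using Fin.cases with
    | zero =>
      have h : (0 : Fin (n + 2)).succ = (0 : Fin (n + 1)).castSucc.succ := rfl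
      have h' : Fin.tail (Fin.contractNth (Fin.castSucc 0) (· * ·) a) = Fin.tail (Fin.tail a) := by
        ext k
        simp [Fin.tail, Fin.contractNth]
      rw [h, face_succ, face_zero, face_zero, h', ← P.left_mul]
      simp [Fin.contractNth, Fin.tail]
    | succ j =>
      induction j using Fin.lastCases with
      | last =>
        have h : (Fin.last n).succ.succ = (Fin.last (n + 1)).succ := rfl
        rw [h, face_last, face_zero, face_last, P.left_right]
        rfl
      | cast j =>
        have h : j.castSucc.succ.succ = j.succ.castSucc.succ := rfl
        have h0 : Fin.contractNth j.succ.castSucc (· * ·) a 0 = a 0 := by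
          simp [Fin.contractNth]
        rw [h, face_succ, face_zero, face_succ, ← Fin.succ_castSucc, tail_contractNth,
          Fin.succ_castSucc, h0]
  | succ i =>
    induction j using Fin.cases with
    | zero => exact absurd hij (by simp)
    | succ j =>
      have hij' : i ≤ j := by simpa using hij
      have hi : i.succ.castSucc = i.castSucc.succ := rfl
      induction i using Fin.lastCases with
      | last =>
        obtain rfl : j = Fin.last n := le_antisymm (Fin.le_last _) hij'
        have h' : Fin.init (Fin.contractNth (Fin.last n).castSucc (· * ·) a) =
            Fin.init (Fin.init a) := by
          ext k
          simp [Fin.init, Fin.contractNth]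
        have h : (Fin.last n).succ.succ = (Fin.last (n + 1)).succ := rfl
        rw [hi, face_succ, h, face_last, face_last, face_last, h', ← P.right_mul]
        simp [Fin.contractNth, Fin.init]
      | cast i =>
        induction j using Fin.lastCases with
        | last =>
          have h : (Fin.last n).succ.succ = (Fin.last (n + 1)).succ := rfl
          have h0 : Fin.contractNth i.castSucc.castSucc (· * ·) a (Fin.last n) =
              a (Fin.last (n + 1)) := by
            rw [Fin.contractNth_apply_of_gt _ _ _ _ (by simp)]
            rfl
          rw [hi, face_succ, h, face_last, face_last, face_succ, init_contractNth, h0]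
        | cast j =>
          have h : j.castSucc.succ.succ = j.succ.castSucc.succ := rfl
          rw [hi, face_succ, h, face_succ, face_succ, face_succ, ← Fin.succ_castSucc,
            contractNth_contractNth _ mul_assoc _ _ hij']

variable [IsScalarTower ℂ A A] [SMulCommClass ℂ A A]

theorem coboundary_eq_sum_face (P : Bimodule A X) (n : ℕ) (f : Cochain A X n)
    (a : Fin (n + 1) → A) :
    coboundary P n f a = ∑ i : Fin (n + 2), (-1 : ℂ) ^ (i : ℕ) • face P f i a := by
  rw [Fin.sum_univ_succ, Fin.sum_univ_castSucc, coboundary_apply]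
  simp only [face_zero, face_succ, face_last, Fin.val_zero, pow_zero, one_smul, Fin.val_succ,
    Fin.val_castSucc, Fin.val_last]
  exact add_assoc _ _ _

theorem coboundary_coboundary (P : Bimodule A X) (n : ℕ) (f : Cochain A X n) :
    coboundary P (n + 1) (coboundary P n f) = 0 := by
  ext a
  have h : (coboundary P n f : (Fin (n + 1) → A) → X) =
      fun b => ∑ i : Fin (n + 2), (-1 : ℂ) ^ (i : ℕ) • face P f i b :=
    funext (coboundary_eq_sum_face P n f)
  rw [coboundary_eq_sum_face, h, zero_apply,
    ← sum_sum_neg_one_pow_eq_zero (fun j i => face P (face P f i) j a)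
      fun i j hij => face_face P f a hij]
  refine Finset.sum_congr rfl fun j _ => ?_
  rw [face_sum_smul, Finset.smul_sum]
  refine Finset.sum_congr rfl fun i _ => ?_
  rw [smul_smul, ← pow_add, add_comm]

end SquareZero

/-! ### A virtual left identity from amenability. -/

section MixedUnit

/-- An amenable Banach algebra `J` has a functional `Φ` on `J*` that acts like the limit of a
bounded left approximate identity: `Φ(x ↦ φ(x a)) = φ(a)`. -/
theorem IsAmenable.exists_mixedUnit {J : Type u} [NonUnitalNormedRing J] [NormedSpace ℂ J]
    [IsScalarTower ℂ J J] [SMulCommClass ℂ J J] (hJ : IsAmenable.{u, max u v} J) :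
    ∃ Φ : StrongDual ℂ (StrongDual ℂ J), ∀ (φ : StrongDual ℂ J) (a : J),
      Φ (φ ∘L (ContinuousLinearMap.mul ℂ J).flip a) = φ a := by
  -- The lift only moves `J*` into the universe in which amenability is assumed.
  let Y : Type (max u v) := ULift.{v} (StrongDual ℂ J)
  let U : Y ≃L[ℂ] StrongDual ℂ J :=
    (LinearIsometryEquiv.ulift ℂ (StrongDual ℂ J)).toContinuousLinearEquiv
  let conj : (StrongDual ℂ J →L[ℂ] StrongDual ℂ J) →L[ℂ] (Y →L[ℂ] Y) :=
    ContinuousLinearMap.compL ℂ Y (StrongDual ℂ J) Y (U.symm : StrongDual ℂ J →L[ℂ] Y) ∘L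
      (ContinuousLinearMap.compL ℂ Y (StrongDual ℂ J) (StrongDual ℂ J)).flip
        (U : Y →L[ℂ] StrongDual ℂ J)
  let act : J →L[ℂ] Y →L[ℂ] Y := conj ∘L transposeL ∘L (ContinuousLinearMap.mul ℂ J).flip
  have act_apply : ∀ (a : J) (y : Y) (x : J), U (act a y) x = U y (x * a) := fun _ _ _ => rfl
  -- With zero right action on `J*`, the left action on the dual is zero, so the cocycle condition
  -- for `D` reads `D(ab) = D(a) · b`.
  let P : Bimodule J Y :=
    { left := act
      right := 0
      left_mul := fun a b y => U.injective <| by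
        ext x
        rw [act_apply, act_apply, act_apply, mul_assoc]
      right_mul := fun _ _ _ => by simp
      left_right := fun _ _ _ => by simp }
  -- The canonical embedding of `J` into `J**`.
  let D : Cochain J (StrongDual ℂ Y) 1 :=
    ContinuousMultilinearMap.ofSubsingleton ℂ J (StrongDual ℂ Y) (0 : Fin 1)
      (ContinuousLinearMap.flip (U : Y →L[ℂ] StrongDual ℂ J))
  have D_apply : ∀ (a : Fin 1 → J) (y : Y), D a y = U y (a 0) := fun _ _ => rfl
  have hD : D ∈ cocycles P.dual 1 := by
    change coboundary P.dual 1 D = 0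
    ext a y
    have hl : ∀ (b : J) (ψ : StrongDual ℂ Y), P.dual.left b ψ y = 0 := fun b ψ =>
      map_zero ψ
    have hr : ∀ (b : J) (ψ : StrongDual ℂ Y), P.dual.right b ψ y = ψ (act b y) := fun _ _ => rfl
    rw [coboundary_apply]
    simp [hl, hr, D_apply, act_apply, Fin.contractNth, Fin.init]
  have hsub := hJ Y P
  have hmem : D ∈ coboundaries P.dual 1 :=
    (Submodule.Quotient.mk_eq_zero ((coboundaries P.dual 1).submoduleOf (cocycles P.dual 1))
      (x := ⟨D, hD⟩)).1 (Subsingleton.elim _ _)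
  obtain ⟨f, hf⟩ := hmem
  -- As the left action is zero, `D = δ f` says `D(a) = -f · a`, which accounts for the sign.
  refine ⟨-(f 0) ∘L (U.symm : StrongDual ℂ J →L[ℂ] Y), fun φ a => ?_⟩
  have h1 := congrArg (fun g : Cochain J (StrongDual ℂ Y) 1 => g (fun _ => a) (U.symm φ)) hf
  have hl : P.dual.left a (f 0) (U.symm φ) = 0 := map_zero (f 0)
  have hr : P.dual.right a (f 0) (U.symm φ) =
    f 0 (U.symm (φ ∘L (ContinuousLinearMap.mul ℂ J).flip a)) := rfl
  have e1 : ∀ b : Fin 0 → J, f b = f 0 := fun b => congrArg f (Subsingleton.elim _ _)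
  simp only [coboundary_apply, D_apply, e1, add_apply, smul_apply, Finset.univ_eq_empty,
    Finset.sum_empty, zero_apply, hl, hr] at h1
  simpa using h1

end MixedUnit

/-! ### Averaging one argument of a cochain over the ideal. -/

section Averaging

variable {A : Type u} [NonUnitalNormedRing A] [NormedSpace ℂ A]
  [IsScalarTower ℂ A A] [SMulCommClass ℂ A A]
  {E : Type v} [NormedAddCommGroup E] [NormedSpace ℂ E]

/-- If `f` vanishes on `I` in its first `p` arguments and `δ f` vanishes on `I`, then `f` is
cohomologous to a cochain that vanishes on `I` in its first `p + 1` arguments. -/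
theorem exists_vanishesBelow_succ {I : ClosedIdeal A} (P : Bimodule A E)
    (hl : ∀ a ∈ I.toSubmodule, P.dual.left a = 0)
    {Φ : StrongDual ℂ (StrongDual ℂ I.subalgebra)}
    (hΦ : ∀ (φ : StrongDual ℂ I.subalgebra) (a : I.subalgebra),
      Φ (φ ∘L (ContinuousLinearMap.mul ℂ I.subalgebra).flip a) = φ a)
    {n : ℕ} (p : Fin (n + 1)) (f : Cochain A (StrongDual ℂ E) (n + 1))
    (hf : VanishesBelow I f p)
    (hδ : VanishesBelow I (coboundary P.dual (n + 1) f) (n + 2)) :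
    ∃ h : Cochain A (StrongDual ℂ E) n,
      VanishesBelow I (f - coboundary P.dual n h) (p + 1) := by
  let incl : I.subalgebra →L[ℂ] A := I.toSubmodule.subtypeL
  -- `T u` plays the role of the weak* limit of `u` along an approximate identity: `Φ` is applied to
  -- `e ↦ u(e)(x)` for each `x` in the predual. This is where a dual module is needed.
  let T : (I.subalgebra →L[ℂ] StrongDual ℂ E) →L[ℂ] StrongDual ℂ E :=
    ContinuousLinearMap.compL ℂ E (StrongDual ℂ I.subalgebra) ℂ Φ ∘L
      (ContinuousLinearMap.flipₗᵢ ℂ I.subalgebra E ℂ).toContinuousLinearEquiv.toContinuousLinearMap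
  have T_apply : ∀ u x, T u x = Φ (u.flip x) := fun _ _ => rfl
  -- Both module actions are transposes, so `T` commutes with them and hence with the formula for
  -- `δ`.
  have T_transpose : ∀ (S : E →L[ℂ] E) u, T (transposeL S ∘L u) = transposeL S (T u) :=
    fun S u => rfl
  have T_mul : ∀ u a, T (u ∘L (ContinuousLinearMap.mul ℂ I.subalgebra).flip a) = u a :=
    fun u a => ContinuousLinearMap.ext fun x => hΦ (u.flip x) a
  let ins : (Fin n → A) → I.subalgebra →L[ℂ] StrongDual ℂ E := fun b =>
    (f.curryMid p ∘L incl).flipMultilinear b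
  have ins_apply : ∀ b e, ins b e = f.curryMid p (e : A) b := fun _ _ => rfl
  let h : Cochain A (StrongDual ℂ E) n :=
    T.compContinuousMultilinearMap (f.curryMid p ∘L incl).flipMultilinear
  have h_apply : ∀ b, h b = T (ins b) := fun _ => rfl
  have hh : VanishesBelow I h p := fun b i hi hb => by
    have : ins b = 0 := by
      ext1 e
      rw [ins_apply, ContinuousMultilinearMap.curryMid_apply]
      refine hf _ i.castSucc hi ?_
      simpa [insertNth_eq_ite, hi] using hb
    rw [h_apply, this, map_zero]
  have key : ∀ a : Fin (n + 1) → A, a p ∈ I.toSubmodule →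
      coboundary P.dual n h a = (-1 : ℂ) ^ ((p : ℕ) + 1) • f a := fun a ha => by
    have h1 : coboundary P.dual n h a = T (P.dual.left (a 0) ∘L ins (Fin.tail a) +
        ∑ i : Fin n, (-1 : ℂ) ^ ((i : ℕ) + 1) • ins (Fin.contractNth i.castSucc (· * ·) a) +
        (-1 : ℂ) ^ (n + 1) • (P.dual.right (a (Fin.last n)) ∘L ins (Fin.init a))) := by
      rw [coboundary_apply]
      simp only [h_apply, map_add, map_sum, map_smul]
      rfl
    -- As a function of `e` the left side is `δ(f.curryMid p e)(a)`, so it is `±f` with `e * a p` in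
    -- place `p`; `T_mul` then removes `e`.
    have h2 : P.dual.left (a 0) ∘L ins (Fin.tail a) +
        ∑ i : Fin n, (-1 : ℂ) ^ ((i : ℕ) + 1) • ins (Fin.contractNth i.castSucc (· * ·) a) +
        (-1 : ℂ) ^ (n + 1) • (P.dual.right (a (Fin.last n)) ∘L ins (Fin.init a)) =
        (-1 : ℂ) ^ ((p : ℕ) + 1) • ((f.toContinuousLinearMap a p ∘L incl) ∘L
          (ContinuousLinearMap.mul ℂ I.subalgebra).flip ⟨a p, ha⟩) := by
      ext1 e
      refine Eq.trans ?_ (coboundary_insertNth P.dual hl p f hf hδ e.2 a ha)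
      rw [coboundary_apply]
      simp [ins_apply]
    rw [h1, h2, map_smul, T_mul]
    congr 1
    change f (Function.update a p (a p)) = f a
    rw [Function.update_eq_self]
  -- The sign is its own inverse. In places before `p` nothing is lost, since `h`, and hence `δ h`,
  -- vanishes there.
  refine ⟨(-1 : ℂ) ^ ((p : ℕ) + 1) • h, fun a i hi ha => ?_⟩
  rw [map_smul, sub_apply, smul_apply]
  rcases Nat.lt_succ_iff_lt_or_eq.1 hi with hi | hi
  · rw [hf a i hi ha, hh.coboundary P.dual hl (by omega) a i hi ha, smul_zero, sub_zero]
  · obtain rfl : i = p := Fin.ext hi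
    rw [key a ha, smul_smul, ← mul_pow]
    simp

end Averaging

/-! ### Bounded coboundary operators and closed spaces of cocycles. -/

section Continuity

variable {A : Type u} [NonUnitalNormedRing A] [NormedSpace ℂ A]
  {X : Type v} [NormedAddCommGroup X] [NormedSpace ℂ X]

/-- By the closed graph theorem, it is enough that each value `δ f a` depends continuously on `f`.
-/
theorem continuous_coboundary [IsScalarTower ℂ A A] [SMulCommClass ℂ A A] [CompleteSpace X]
    (P : Bimodule A X) (n : ℕ) : Continuous (coboundary P n) := by
  refine LinearMap.continuous_of_seq_closed_graph _ fun u x y hu hy => ?_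
  ext a
  have h1 : Filter.Tendsto (fun k => coboundary P n (u k) a) Filter.atTop (nhds (y a)) :=
    ((continuous_eval_const a).tendsto y).comp hy
  have h2 : Continuous fun f : Cochain A X n => coboundary P n f a := by
    simp only [coboundary_apply]
    have (b : Fin n → A) : Continuous fun f : Cochain A X n => f b :=
      continuous_eval_const b
    fun_prop
  exact tendsto_nhds_unique h1 ((h2.tendsto x).comp hu)

theorem continuous_pullback {B : Type w} [NonUnitalNormedRing B] [NormedSpace ℂ B]
    (φ : A →L[ℂ] B) (n : ℕ) : Continuous (pullback X φ n) :=
  (ContinuousMultilinearMap.compContinuousLinearMapL (F := X)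
    (fun _ : Fin n => φ)).continuous

variable [IsScalarTower ℂ A A] [SMulCommClass ℂ A A]

theorem isClosed_cocycles [CompleteSpace X] (P : Bimodule A X) (n : ℕ) :
    IsClosed (cocycles P n : Set (Cochain A X n)) :=
  isClosed_singleton.preimage (continuous_coboundary P n)

theorem coboundaries_le_cocycles (P : Bimodule A X) (n : ℕ) :
    coboundaries P n ≤ cocycles P n := by
  cases n with
  | zero => exact bot_le
  | succ n =>
    rintro _ ⟨g, rfl⟩
    exact coboundary_coboundary P n g

/-- The coboundaries are the range of a bounded operator between Banach spaces, in degree `0`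
also. -/
theorem exists_range_eq_coboundaries [CompleteSpace X] (P : Bimodule A X) (n : ℕ) :
    ∃ (k : ℕ) (d : Cochain A X k →L[ℂ] cocycles P n),
      ∀ c : cocycles P n, (c : Cochain A X n) ∈ coboundaries P n ↔ ∃ x, d x = c := by
  cases n with
  | zero =>
    refine ⟨0, 0, fun c => ?_⟩
    change (c : Cochain A X 0) = 0 ↔ _
    simp [eq_comm]
  | succ n =>
    refine ⟨n, (⟨coboundary P n, continuous_coboundary P n⟩ :
      Cochain A X n →L[ℂ] Cochain A X (n + 1)).codRestrict (cocycles P (n + 1))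
        (coboundary_coboundary P n), fun c => ?_⟩
    exact exists_congr fun _ => ⟨fun h => Subtype.ext h, congrArg Subtype.val⟩

end Continuity

/-! ### Openness of maps between non-Hausdorff quotients. -/

section Quotient

/-- The open mapping theorem applies to the Banach space surjection `(x, w) ↦ θ x + d w`. Modulo `T`
the summand `d w` disappears, so this map followed by `T.mkQ` factors through the induced map, which
is therefore open. -/
theorem isOpenMap_mapQ {X Y W : Type*} [NormedAddCommGroup X] [NormedSpace ℂ X]
    [NormedAddCommGroup Y] [NormedSpace ℂ Y] [NormedAddCommGroup W] [NormedSpace ℂ W]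
    [CompleteSpace W] {X' : Submodule ℂ X} {Y' : Submodule ℂ Y} [CompleteSpace X']
    [CompleteSpace Y'] (S : Submodule ℂ X') (T : Submodule ℂ Y') (θ : X' →ₗ[ℂ] Y')
    (hθ : Continuous θ) (d : W →L[ℂ] Y') (hST : S ≤ T.comap θ) (hd : ∀ w, d w ∈ T)
    (hsurj : ∀ y, ∃ x w, θ x + d w = y) : IsOpenMap (S.mapQ T θ hST) := by
  let θ' : X' →L[ℂ] Y' := ⟨θ, hθ⟩
  have hopen : IsOpenMap (θ'.coprod d) := ContinuousLinearMap.isOpenMap _ fun y => by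
    obtain ⟨x, w, h⟩ := hsurj y
    exact ⟨(x, w), h⟩
  intro U hU
  have hV : IsOpen {z : X' × W | S.mkQ z.1 ∈ U} :=
    hU.preimage (continuous_quot_mk.comp continuous_fst)
  convert (T.isOpenMap_mkQ.comp hopen) _ hV using 1
  have hmk : ∀ z : X' × W, T.mkQ (θ'.coprod d z) = S.mapQ T θ hST (S.mkQ z.1) :=
    fun z => by
      have h0 : T.mkQ (d z.2) = 0 := (Submodule.Quotient.mk_eq_zero T).2 (hd z.2)
      rw [ContinuousLinearMap.coprod_apply, map_add, h0, add_zero]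
      rfl
  ext q
  constructor
  · rintro ⟨r, hr, rfl⟩
    obtain ⟨x, rfl⟩ := S.mkQ_surjective r
    exact ⟨(x, 0), hr, hmk (x, 0)⟩
  · rintro ⟨z, hz, rfl⟩
    exact ⟨_, hz, (hmk z).symm⟩

end Quotient

/-! ### Descent of cochains to the quotient algebra. -/

section Ideals

variable {A : Type u} [NonUnitalNormedRing A] [NormedSpace ℂ A] (I : ClosedIdeal A)
  {X : Type v} [NormedAddCommGroup X] [NormedSpace ℂ X]

namespace ClosedIdeal

theorem isOpenQuotientMap_quotMap : IsOpenQuotientMap I.quotMap where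
  surjective := I.quotMap_surjective
  continuous := I.quotMap.continuous
  isOpenMap := I.toSubmodule.isOpenMap_mkQ

theorem quotMap_eq_zero {a : A} (ha : a ∈ I.toSubmodule) : I.quotMap a = 0 :=
  (Submodule.Quotient.mk_eq_zero I.toSubmodule).2 ha

end ClosedIdeal

theorem pullback_quotMap_injective (n : ℕ) :
    Function.Injective (pullback X I.quotMap n) := fun f g h => by
  ext b
  choose s hs using I.quotMap_surjective
  have := congrArg (fun k : Cochain A X n => k fun i => s (b i)) h
  simpa [pullback_apply, hs] using this

theorem vanishesBelow_pullback {n : ℕ} (g : Cochain I.Quotient X n) (k : ℕ) :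
    VanishesBelow I (pullback X I.quotMap n g) k := fun _ i _ ha =>
  g.map_coord_zero i (I.quotMap_eq_zero ha)

variable {I}

/-- The arguments are exchanged one at a time; each exchange alters the value by `f` at a tuple with
an entry in `I`. -/
theorem VanishesBelow.apply_eq {n : ℕ} {f : Cochain A X n} (hf : VanishesBelow I f n)
    {a b : Fin n → A} (hab : ∀ i, I.quotMap (a i) = I.quotMap (b i)) : f a = f b := by
  have h : ∀ s : Finset (Fin n), f (s.piecewise a b) = f b := fun s => by
    induction s using Finset.induction_on with
    | empty => rw [Finset.piecewise_empty]
    | insert i s hi ih =>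
      rw [← ih, Finset.piecewise_insert, ← sub_eq_zero]
      have e : s.piecewise a b = Function.update (s.piecewise a b) i (b i) := by
        rw [eq_comm, Function.update_eq_self_iff, Finset.piecewise_eq_of_notMem _ _ _ hi]
      rw [e, Function.update_idem, ← f.map_update_sub]
      exact hf _ i i.2 (by simpa using I.quotMap_eq_iff.1 (hab i))
  simpa using h Finset.univ

/-- A cochain that vanishes as soon as one argument lies in `I` descends to `A / I`. -/
theorem VanishesBelow.exists_pullback_eq {n : ℕ} {f : Cochain A X n} (hf : VanishesBelow I f n) :
    ∃ g : Cochain I.Quotient X n, pullback X I.quotMap n g = f := by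
  -- An arbitrary set-theoretic section suffices, since `f` does not see the choice of
  -- representatives.
  choose s hs using I.quotMap_surjective
  have key : ∀ a : Fin n → A, f (fun i => s (I.quotMap (a i))) = f a := fun a =>
    hf.apply_eq fun i => hs _
  have hupd : ∀ (m : Fin n → I.Quotient) (i : Fin n) (x : I.Quotient) (y : A),
      I.quotMap y = x → f (fun j => s (Function.update m i x j)) =
        f (Function.update (fun j => s (m j)) i y) := fun m i x y hy => hf.apply_eq fun j => by
    by_cases hj : j = i
    · subst hj; simp [hs, hy]
    · simp [hs, hj]
  refine ⟨{ toFun := fun b => f fun i => s (b i)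
            map_update_add' := ?_
            map_update_smul' := ?_
            cont := ?_ }, ?_⟩
  · intro inst m i x y
    obtain rfl : inst = instDecidableEqFin n := Subsingleton.elim _ _
    rw [hupd m i (x + y) (s x + s y) (by rw [map_add, hs, hs]), hupd m i x _ (hs x),
      hupd m i y _ (hs y)]
    exact f.map_update_add _ _ _ _
  · intro inst m i c x
    obtain rfl : inst = instDecidableEqFin n := Subsingleton.elim _ _
    rw [hupd m i (c • x) (c • s x) (by rw [map_smul, hs]), hupd m i x _ (hs x)]
    exact f.map_update_smul _ _ _ _
  -- The section need not be continuous; continuity is checked after composing with the quotient map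
  -- `Aⁿ → (A / I)ⁿ`.
  · have hq : IsOpenQuotientMap (Pi.map fun _ : Fin n => (I.quotMap : A → I.Quotient)) :=
      IsOpenQuotientMap.piMap fun _ => I.isOpenQuotientMap_quotMap
    refine hq.isQuotientMap.continuous_iff.2 ?_
    exact f.cont.congr fun a => (key a).symm
  · ext a
    exact key a

end Ideals

/-! ### The isomorphism in cohomology. -/

section Isomorphism

variable {A : Type u} [NonUnitalNormedRing A] [NormedSpace ℂ A]
  [IsScalarTower ℂ A A] [SMulCommClass ℂ A A] {I : ClosedIdeal A}
  {E : Type v} [NormedAddCommGroup E] [NormedSpace ℂ E]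

/-- If `δ f` vanishes on `I`, then `f` is cohomologous to a cochain pulled back from `A / I`. -/
theorem exists_eq_pullback_add
    (hI : IsAmenable.{u, max u v} I.subalgebra) (P : Bimodule I.Quotient E) (n : ℕ)
    (f : Cochain A (StrongDual ℂ E) n)
    (hδ : VanishesBelow I (coboundary (P.dual.restrict I.quotMap I.quotMap_mul) n f) (n + 1)) :
    ∃ (g : Cochain I.Quotient (StrongDual ℂ E) n),
      ∃ c ∈ coboundaries (P.dual.restrict I.quotMap I.quotMap_mul) n,
        f = pullback _ I.quotMap n g + c := by
  cases n with
  | zero =>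
    obtain ⟨g, hg⟩ := VanishesBelow.exists_pullback_eq (I := I) (f := f) fun _ i => i.elim0
    exact ⟨g, 0, Submodule.zero_mem _, by rw [hg, add_zero]⟩
  | succ n =>
    obtain ⟨Φ, hΦ⟩ := hI.exists_mixedUnit
    let Q : Bimodule A E := P.restrict I.quotMap I.quotMap_mul
    have hl : ∀ a ∈ I.toSubmodule, Q.dual.left a = 0 := fun a ha => by
      change P.dual.left (I.quotMap a) = 0
      rw [I.quotMap_eq_zero ha, map_zero]
    have h : ∀ k ≤ n + 1, ∃ h : Cochain A (StrongDual ℂ E) n,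
        VanishesBelow I (f - coboundary Q.dual n h) k := fun k => by
      induction k with
      | zero => exact fun _ => ⟨0, fun _ _ hi => absurd hi (Nat.not_lt_zero _)⟩
      | succ k ih =>
        intro hk
        obtain ⟨h, hh⟩ := ih (by omega)
        -- Subtracting a coboundary leaves `δ f` unchanged, so the hypothesis on `δ f` is available
        -- at each place.
        obtain ⟨h', hh'⟩ := exists_vanishesBelow_succ Q hl hΦ ⟨k, hk⟩ _ hh (by
          rw [map_sub, coboundary_coboundary, sub_zero]
          exact hδ)
        exact ⟨h + h', by rwa [map_add, ← sub_sub]⟩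
    obtain ⟨h, hh⟩ := h (n + 1) le_rfl
    obtain ⟨g, hg⟩ := hh.exists_pullback_eq
    exact ⟨g, coboundary Q.dual n h, ⟨h, rfl⟩, by rw [hg, sub_add_cancel]⟩

variable (P : Bimodule I.Quotient E) (n : ℕ)

theorem cocycle_eq_pullback_add (hI : IsAmenable.{u, max u v} I.subalgebra)
    (f : cocycles (P.dual.restrict I.quotMap I.quotMap_mul) n) :
    ∃ (g : cocycles P.dual n) (c : cocycles (P.dual.restrict I.quotMap I.quotMap_mul) n),
      (c : Cochain A (StrongDual ℂ E) n) ∈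
        coboundaries (P.dual.restrict I.quotMap I.quotMap_mul) n ∧
        pullbackCocycles P.dual I.quotMap I.quotMap_mul n g + c = f := by
  have hf : coboundary (P.dual.restrict I.quotMap I.quotMap_mul) n f = 0 := f.2
  obtain ⟨g, c, hc, h⟩ := exists_eq_pullback_add hI P n f fun _ _ _ _ => by rw [hf]; rfl
  have hc' : coboundary (P.dual.restrict I.quotMap I.quotMap_mul) n c = 0 :=
    coboundaries_le_cocycles _ n hc
  have hg : coboundary P.dual n g = 0 := by
    apply pullback_quotMap_injective I
    rw [← coboundary_pullback _ _ I.quotMap_mul, map_zero, ← hf, h, map_add, hc', add_zero]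
  exact ⟨⟨g, hg⟩, ⟨c, hc'⟩, hc, Subtype.ext h.symm⟩

theorem cohomologyMap_quotMap_surjective (hI : IsAmenable.{u, max u v} I.subalgebra) :
    Function.Surjective (cohomologyMap P.dual I.quotMap I.quotMap_mul n) := fun x => by
  obtain ⟨f, rfl⟩ := Submodule.mkQ_surjective _ x
  obtain ⟨g, c, hc, rfl⟩ := cocycle_eq_pullback_add P n hI f
  refine ⟨Submodule.mkQ _ g, (Submodule.Quotient.eq _).2 ?_⟩
  rw [sub_add_cancel_left]
  exact Submodule.neg_mem _ hc

/-- If the pullback of a cocycle is `δ g`, then `δ g` vanishes on `I`, although `g` need not be a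
cocycle. So `g` may be replaced by a pulled back cochain with the same coboundary, and pullback is
injective on cochains. -/
theorem cohomologyMap_quotMap_injective (hI : IsAmenable.{u, max u v} I.subalgebra) :
    Function.Injective (cohomologyMap P.dual I.quotMap I.quotMap_mul n) := by
  rw [injective_iff_map_eq_zero]
  intro x hx
  obtain ⟨f, rfl⟩ := Submodule.mkQ_surjective _ x
  have hf : pullback _ I.quotMap n f.1 ∈
      coboundaries (P.dual.restrict I.quotMap I.quotMap_mul) n :=
    (Submodule.Quotient.mk_eq_zero ((coboundaries _ n).submoduleOf (cocycles _ n))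
      (x := pullbackCocycles P.dual I.quotMap I.quotMap_mul n f)).1 hx
  refine (Submodule.Quotient.mk_eq_zero _).2 ?_
  change f.1 ∈ coboundaries P.dual n
  cases n with
  | zero =>
    have hf0 : pullback _ I.quotMap 0 f.1 = 0 := hf
    exact pullback_quotMap_injective I 0 (hf0.trans (map_zero _).symm)
  | succ n =>
    obtain ⟨g, hg⟩ := hf
    obtain ⟨g', c, hc, h⟩ := exists_eq_pullback_add hI P n g
      (by rw [hg]; exact vanishesBelow_pullback I _ _)
    have hc' : coboundary (P.dual.restrict I.quotMap I.quotMap_mul) n c = 0 :=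
      coboundaries_le_cocycles _ n hc
    refine ⟨g', pullback_quotMap_injective I _ ?_⟩
    rw [← coboundary_pullback _ _ I.quotMap_mul, ← hg, h, map_add, hc', add_zero]

theorem continuous_pullbackCocycles :
    Continuous (pullbackCocycles P.dual I.quotMap I.quotMap_mul n) :=
  ((continuous_pullback I.quotMap n).comp continuous_subtype_val).subtype_mk _

theorem continuous_cohomologyMap_quotMap :
    Continuous (cohomologyMap P.dual I.quotMap I.quotMap_mul n) :=
  Continuous.quotient_lift (continuous_quot_mk.comp (continuous_pullbackCocycles P n)) _

theorem isOpenMap_cohomologyMap_quotMap (hI : IsAmenable.{u, max u v} I.subalgebra) :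
    IsOpenMap (cohomologyMap P.dual I.quotMap I.quotMap_mul n) := by
  have := (isClosed_cocycles P.dual n).completeSpace_coe
  have := (isClosed_cocycles (P.dual.restrict I.quotMap I.quotMap_mul) n).completeSpace_coe
  obtain ⟨k, d, hd⟩ :=
    exists_range_eq_coboundaries (P.dual.restrict I.quotMap I.quotMap_mul) n
  refine isOpenMap_mapQ _ _ _ (continuous_pullbackCocycles P n) d _
    (fun w => (hd _).2 ⟨w, rfl⟩) fun f => ?_
  obtain ⟨g, c, hc, h⟩ := cocycle_eq_pullback_add P n hI f
  obtain ⟨w, rfl⟩ := (hd c).1 hc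
  exact ⟨g, w, h⟩

end Isomorphism

end BanachCohomology

end

theorem theorem2p1 {A : Type u} [NonUnitalNormedRing A] [NormedSpace ℂ A]
    [IsScalarTower ℂ A A] [SMulCommClass ℂ A A] [CompleteSpace A]
    (I : BanachCohomology.ClosedIdeal A)
    (hI : BanachCohomology.IsAmenable.{u, max u v} I.subalgebra)
    {E : Type v} [NormedAddCommGroup E] [NormedSpace ℂ E] [CompleteSpace E]
    (P : BanachCohomology.Bimodule I.Quotient E) (n : ℕ) :
    ∃ e : BanachCohomology.Cohomology P.dual n ≃L[ℂ]
        BanachCohomology.Cohomology (P.dual.restrict I.quotMap I.quotMap_mul) n,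
      ∀ x, e x = BanachCohomology.cohomologyMap P.dual I.quotMap I.quotMap_mul n x := by
  let e := LinearEquiv.ofBijective
    (BanachCohomology.cohomologyMap P.dual I.quotMap I.quotMap_mul n)
    ⟨BanachCohomology.cohomologyMap_quotMap_injective P n hI,
      BanachCohomology.cohomologyMap_quotMap_surjective P n hI⟩
  have hc : Continuous e := BanachCohomology.continuous_cohomologyMap_quotMap P n
  have ho : IsOpenMap e := BanachCohomology.isOpenMap_cohomologyMap_quotMap P n hI
  exact ⟨⟨e, hc, (e.toEquiv.toHomeomorphOfContinuousOpen hc ho).continuous_invFun⟩,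
    fun _ => rfl⟩
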